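/- Let $n,d\ge 1$, and let $b_1,\dots,b_d\in\mathbb{R}^n$ be linearly independent vectors, with Gram–Schmidt orthogonalisation $b_1^*,\dots,b_d^*$ (without normalisation: $b_i^*=b_i-\sum_{j<i}\mu_{i,j}b_j^*$ with $\mu_{i,j}=\langle b_i,b_j^*\rangle/\|b_j^*\|^2$), where $\|\cdot\|$ and $\langle\cdot,\cdot\rangle$ are the Euclidean norm and inner product. The basis $(b_1,\dots,b_d)$ is called HKZ-reduced (Hermite–Korkine–Zolotarev-reduced) if $|\mu_{i,j}|\le 1/2$ for all $1\le j<i\le d$, if $b_1$ is a shortest non-zero vector of the lattice $\mathbb{Z}b_1+\dots+\mathbb{Z}b_d$, and if (recursively) the orthogonal projections of $b_2,\dots,b_d$ onto the orthogonal complement of $b_1$ form an HKZ-reduced basis, the empty family being HKZ-reduced. Suppose that $(b_1,\dots,b_d)$ is HKZ-reduced, and let $I\subset\{1,\dots,d\}$ be any subset. Then $$\frac{\|b_1\|^{|I|}}{\prod_{i\in I}\|b_i^*\|}\;\le\;(\sqrt{d})^{|I|\left(1+\log\frac{d}{|I|}\right)}\;\le\;(\sqrt{d})^{\frac{d}{e}+|I|},$$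 where $\log$ is the natural logarithm, and the exponent $|I|\left(1+\log\frac{d}{|I|}\right)$ is read as $0$ if $I=\emptyset$. -/

import Mathlib

noncomputable section

/-- The coefficient `μ_{i,j} = ⟪b_i, b_j^*⟫ / ‖b_j^*‖²` of a family of vectors with respect to its
Gram-Schmidt orthogonalisation (without normalisation). -/
def gsoCoeff {n d : ℕ} (b : Fin d → EuclideanSpace ℝ (Fin n)) (i j : Fin d) : ℝ :=
  inner ℝ (b i) (InnerProductSpace.gramSchmidt ℝ b j) /
    ‖InnerProductSpace.gramSchmidt ℝ b j‖ ^ 2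

/-- Size-reduction: `|μ_{i,j}| ≤ 1/2` for all `j < i`. -/
def IsSizeReduced {n d : ℕ} (b : Fin d → EuclideanSpace ℝ (Fin n)) : Prop :=
  ∀ i j : Fin d, j < i → |gsoCoeff b i j| ≤ 1 / 2

/-- The lattice spanned by a family of vectors: its integer linear combinations. -/
def latticeOf {n d : ℕ} (b : Fin d → EuclideanSpace ℝ (Fin n)) :
    Submodule ℤ (EuclideanSpace ℝ (Fin n)) :=
  Submodule.span ℤ (Set.range b)

/-- The minimum of a lattice: the radius of the smallest closed ball centred at the origin that
contains a non-zero lattice vector. -/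
def latticeMinimum {n : ℕ} (L : Submodule ℤ (EuclideanSpace ℝ (Fin n))) : ℝ :=
  sInf {r : ℝ | ∃ v ∈ L, v ≠ 0 ∧ v ∈ Metric.closedBall 0 r}

/-- The projections of all vectors of the family but the first, orthogonally to the first one. -/
def projectedTail {n d : ℕ} (b : Fin (d + 1) → EuclideanSpace ℝ (Fin n)) :
    Fin d → EuclideanSpace ℝ (Fin n) :=
  fun i => (Submodule.span ℝ {b 0})ᗮ.starProjection (b i.succ)

/-- Hermite-Korkine-Zolotarev reduction of a linearly independent family, by recursion on its
length: the family is size-reduced, its first vector reaches the minimum of the lattice, and the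
projections of the others orthogonally to the first vector are again reduced. The empty family is
reduced. -/
def IsHKZReduced {n : ℕ} : (d : ℕ) → (Fin d → EuclideanSpace ℝ (Fin n)) → Prop
  | 0, _ => True
  | d + 1, b =>
      IsSizeReduced b ∧
      ‖b 0‖ = latticeMinimum (latticeOf b) ∧
      IsHKZReduced d (projectedTail b)

end

open Finset Real

/-! Put `x i = log ‖b_i*‖` and `L = log √d`. Minkowski's theorem for the first `r + 1` vectors
bounds `x 0` by `L` plus the mean of the next `r` values. Antitone weights are nonnegative
combinations of prefix indicators, so the same holds for every antitone weighted mean, and at every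
level of the HKZ recursion: this is `IsTailDominated`.

The indicator of `I` need not be antitone. `exists_antitone_profile` makes it so from the last index
backwards: at an index outside `I`, the later weights are cut at a level `s` and the removed mass,
again `s`, moves to this index. The move costs `s * L`, and the entropy `∑ -p log p` grows by at
least `s`, so entropy times `L` pays for all moves. Domination of `x 0` by the final profile costs
at most `|I| * L` more, and by concavity the entropy of mass `|I|` on `d` slots is at most `|I| log
(d / |I|)`. -/

/-! ### Entropy and antitone weights -/

/-- The concave function `-x log x` lies below its tangent lines. -/
theorem negMulLog_le_tangent {q s : ℝ} (hq : 0 ≤ q) (hs : 0 < s) :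
    negMulLog q ≤ negMulLog s + (-log s - 1) * (q - s) := by
  rcases hq.eq_or_lt with rfl | hq
  · simp only [negMulLog]; norm_num; nlinarith
  · have h := Real.log_le_sub_one_of_pos (div_pos hs hq)
    rw [Real.log_div hs.ne' hq.ne'] at h
    have h2 : q * (log s - log q) ≤ q * (s / q - 1) := mul_le_mul_of_nonneg_left h hq.le
    have h3 : q * (s / q - 1) = s - q := by field_simp
    simp only [negMulLog]
    nlinarith

/-- Jensen's inequality: the tangent is taken at the mean `t / d`, so the linear terms cancel in the
sum. -/
theorem sum_negMulLog_le {d : ℕ} (p : Fin d → ℝ) (hp : ∀ i, 0 ≤ p i) {t : ℝ} (ht : 0 < t)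
    (hd : 0 < d) (hsum : ∑ i, p i = t) :
    ∑ i, negMulLog (p i) ≤ t * log (d / t) := by
  have hd' : (0 : ℝ) < d := by exact_mod_cast hd
  have hc : 0 < t / d := div_pos ht hd'
  calc ∑ i, negMulLog (p i)
      ≤ ∑ i, (negMulLog (t / d) + (-log (t / d) - 1) * (p i - t / d)) :=
        Finset.sum_le_sum fun i _ => negMulLog_le_tangent (hp i) hc
    _ = t * log (d / t) := by
        rw [Finset.sum_add_distrib, ← Finset.mul_sum, Finset.sum_sub_distrib, hsum]
        simp only [sum_const, card_univ, Fintype.card_fin, nsmul_eq_mul, negMulLog]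
        rw [← inv_div t (d : ℝ), Real.log_inv]
        field_simp
        ring

/-- A sum with nonnegative antitone weights is nonnegative when all prefix sums are. -/
theorem sum_mul_nonneg_of_antitone {m : ℕ} (w y : Fin m → ℝ) (hw : Antitone w) (hw0 : ∀ i, 0 ≤ w i)
    (hy : ∀ r : ℕ, ∀ hr : r ≤ m, 0 ≤ ∑ i : Fin r, y (Fin.castLE hr i)) :
    0 ≤ ∑ i, w i * y i := by
  -- Abel summation as an induction: lowering the weight in front of a nonnegative prefix sum only
  -- decreases the left side.
  suffices h : ∀ r : ℕ, ∀ hr : r + 1 ≤ m,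
      w ⟨r, hr⟩ * ∑ i : Fin (r + 1), y (Fin.castLE hr i) ≤
        ∑ i : Fin (r + 1), w (Fin.castLE hr i) * y (Fin.castLE hr i) by
    cases m with
    | zero => simp
    | succ n =>
      have h1 := h n le_rfl
      exact (mul_nonneg (hw0 _) (hy _ le_rfl)).trans h1
  intro r
  induction r with
  | zero =>
    intro hr
    rw [Fin.sum_univ_castSucc, Fin.sum_univ_castSucc]
    simp only [univ_eq_empty, sum_empty, zero_add]
    exact le_rfl
  | succ r ih =>
    intro hr
    have hr' : r + 1 ≤ m := by omega
    have h1 := ih hr'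
    rw [Fin.sum_univ_castSucc (n := r + 1), Fin.sum_univ_castSucc (n := r + 1), mul_add]
    have h2 : w ⟨r + 1, hr⟩ ≤ w ⟨r, hr'⟩ := hw (by simp [Fin.le_def])
    have h3 := mul_le_mul_of_nonneg_right h2 (hy _ hr')
    exact add_le_add (h3.trans h1) le_rfl

/-- The level at which a nonnegative family has to be cut off in order that the part cut off
fills one more slot up to this level. -/
theorem exists_eq_sum_posPart {m : ℕ} (q : Fin m → ℝ) (hq1 : ∀ i, q i ≤ 1) :
    ∃ s : ℝ, 0 ≤ s ∧ s ≤ 1 ∧ ∑ i, max (q i - s) 0 = s := by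
  have hc : ContinuousOn (fun s : ℝ => s - ∑ i, max (q i - s) 0) (Set.Icc 0 1) := by fun_prop
  have h0 : (0 : ℝ) ∈ Set.Icc ((0 : ℝ) - ∑ i, max (q i - 0) 0) (1 - ∑ i, max (q i - 1) 0) := by
    constructor
    · have : 0 ≤ ∑ i, max (q i - 0) 0 := Finset.sum_nonneg fun i _ => le_max_right _ _
      linarith
    · rw [Finset.sum_eq_zero fun i _ => max_eq_right (by linarith [hq1 i])]
      norm_num
  obtain ⟨s, hs, h⟩ := intermediate_value_Icc zero_le_one hc h0
  exact ⟨s, hs.1, hs.2, by simp only at h; linarith⟩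

/-! ### Flattening a set to an antitone profile -/

/-- A family of reals, each of which exceeds weighted averages of its successors with antitone
weights by at most `L`. -/
def IsTailDominated (L : ℝ) : (d : ℕ) → (Fin d → ℝ) → Prop
  | 0, _ => True
  | d + 1, x =>
      (∀ w : Fin d → ℝ, Antitone w → (∀ i, 0 ≤ w i) →
        (∑ i, w i) * x 0 ≤ (∑ i, w i) * L + ∑ i, w i * x i.succ) ∧
      IsTailDominated L d (fun i => x i.succ)

theorem antitone_cons {d : ℕ} {a : ℝ} {q : Fin d → ℝ} (hq : Antitone q) (ha : ∀ i, q i ≤ a) :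
    Antitone (Fin.cons a q : Fin (d + 1) → ℝ) := by
  intro i j hij
  induction i using Fin.cases with
  | zero =>
    induction j using Fin.cases with
    | zero => exact le_rfl
    | succ j => simpa using ha j
  | succ i =>
    induction j using Fin.cases with
    | zero => simp at hij
    | succ j => simpa using hq (Fin.succ_le_succ_iff.1 hij)

theorem min_add_posPart (a s : ℝ) : min a s + max (a - s) 0 = a := by
  rcases le_total a s with h | h
  · rw [min_eq_left h, max_eq_right (by linarith)]; ring
  · rw [min_eq_right h, max_eq_left (by linarith)]; ring

/-- Cutting off a family at level `s` and filling one more slot with the part cut off increases the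
entropy by at least `s`. -/
theorem entropy_cut {m : ℕ} (q : Fin m → ℝ) (hq : ∀ i, 0 ≤ q i) {s : ℝ} (hs : 0 ≤ s)
    (h : ∑ i, max (q i - s) 0 = s) :
    s + ∑ i, negMulLog (q i) ≤ negMulLog s + ∑ i, negMulLog (min (q i) s) := by
  rcases hs.eq_or_lt with rfl | hs
  · have : ∀ i, q i = 0 := by
      intro i
      have := (Finset.sum_eq_zero_iff_of_nonneg fun i _ => le_max_right (q i - 0) 0).1 h i (mem_univ i)
      have h2 := le_max_left (q i - 0) 0
      linarith [hq i]
    simp [this]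
  -- Tangent at `s`: as the total excess is `s`, the linear terms add up to `negMulLog s - s`.
  · have key : ∀ i, negMulLog (q i) ≤
        negMulLog (min (q i) s) + (-log s - 1) * max (q i - s) 0 := by
      intro i
      rcases le_total (q i) s with h1 | h1
      · rw [min_eq_left h1, max_eq_right (by linarith)]; simp
      · rw [min_eq_right h1, max_eq_left (by linarith)]
        exact negMulLog_le_tangent (hq i) hs
    have h2 := Finset.sum_le_sum fun i (_ : i ∈ univ) => key i
    rw [Finset.sum_add_distrib, ← Finset.mul_sum, h] at h2
    have h3 : (-log s - 1) * s = negMulLog s - s := by simp only [negMulLog]; ring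
    linarith

/-- The mass on the members of `I` can be flattened to an antitone profile, at a cost of `L` times
the entropy of the profile. -/
theorem exists_antitone_profile {L : ℝ} (hL : 0 ≤ L) : ∀ (d : ℕ) (x : Fin d → ℝ),
    IsTailDominated L d x → ∀ u : Fin d → ℝ, (∀ i, u i = 0 ∨ u i = 1) →
    ∃ p : Fin d → ℝ, Antitone p ∧ (∀ i, 0 ≤ p i) ∧ (∀ i, p i ≤ 1) ∧ ∑ i, p i = ∑ i, u i ∧
      ∑ i, p i * x i ≤ ∑ i, u i * x i + L * ∑ i, negMulLog (p i) := by
  intro d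
  induction d with
  | zero => intro x _ u _; exact ⟨0, fun _ _ _ => le_rfl, by simp, by simp, by simp, by simp⟩
  | succ d ih =>
    intro x hx u hu
    obtain ⟨hx0, hxt⟩ := hx
    obtain ⟨q, hqa, hq0, hq1, hqs, hqx⟩ := ih _ hxt (fun i => u i.succ) (fun i => hu _)
    rcases hu 0 with h0 | h0
    -- Index outside `I`: the excess above `s` is itself antitone, so domination bounds the cost of
    -- moving it to the front.
    · obtain ⟨s, hs0, hs1, hs⟩ := exists_eq_sum_posPart q hq1
      refine ⟨Fin.cons s fun i => min (q i) s,
        antitone_cons (fun i j hij => min_le_min_right _ (hqa hij)) fun i => min_le_right _ _,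
        ?_, ?_, ?_, ?_⟩
      · exact Fin.cases hs0 fun i => le_min (hq0 i) hs0
      · exact Fin.cases hs1 fun i => (min_le_left _ _).trans (hq1 i)
      · rw [Fin.sum_univ_succ, Fin.sum_univ_succ, ← hqs, h0]
        simp only [Fin.cons_zero, Fin.cons_succ]
        have : ∑ i, q i = ∑ i, min (q i) s + ∑ i, max (q i - s) 0 := by
          rw [← Finset.sum_add_distrib]
          exact Finset.sum_congr rfl fun i _ => (min_add_posPart _ _).symm
        linarith
      · rw [Fin.sum_univ_succ, Fin.sum_univ_succ, Fin.sum_univ_succ, h0]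
        simp only [Fin.cons_zero, Fin.cons_succ]
        have h1 := hx0 (fun i => max (q i - s) 0)
          (fun i j hij => max_le_max_right _ (by linarith [hqa hij])) fun i => le_max_right _ _
        rw [hs] at h1
        have h2 : ∑ i, q i * x i.succ =
            ∑ i, min (q i) s * x i.succ + ∑ i, max (q i - s) 0 * x i.succ := by
          rw [← Finset.sum_add_distrib]
          refine Finset.sum_congr rfl fun i _ => ?_
          rw [← add_mul, min_add_posPart]
        have h3 := mul_le_mul_of_nonneg_left (entropy_cut q hq0 hs0 hs) hL
        linarith
    -- Index in `I`: it keeps weight 1, which has zero entropy; the bound `q ≤ 1` preserves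
    -- monotonicity.
    · refine ⟨Fin.cons 1 q, antitone_cons hqa hq1, ?_, ?_, ?_, ?_⟩
      · exact Fin.cases zero_le_one hq0
      · exact Fin.cases le_rfl hq1
      · rw [Fin.sum_univ_succ, Fin.sum_univ_succ]
        simp [hqs, h0]
      · rw [Fin.sum_univ_succ, Fin.sum_univ_succ, Fin.sum_univ_succ]
        simp only [Fin.cons_zero, Fin.cons_succ, h0, negMulLog_one]
        linarith

theorem isTailDominated_mul_sub_sum_le {L : ℝ} (hL : 0 ≤ L) {d : ℕ} (x : Fin (d + 1) → ℝ)
    (hx : IsTailDominated L (d + 1) x) (I : Finset (Fin (d + 1))) (hI : I.Nonempty) :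
    (#I : ℝ) * x 0 - ∑ i ∈ I, x i ≤
      L * ((#I : ℝ) * (1 + log (((d + 1 : ℕ) : ℝ) / (#I : ℝ)))) := by
  obtain ⟨p, hpa, hp0, -, hps, hpx⟩ := exists_antitone_profile hL (d + 1) x hx
    (fun i => if i ∈ I then 1 else 0) (fun i => by by_cases h : i ∈ I <;> simp [h])
  simp only [ite_mul, one_mul, zero_mul, Finset.sum_ite_mem, Finset.univ_inter] at hpx
  have hcard : ∑ i, p i = (#I : ℝ) := by rw [hps]; simp
  have h1 := hx.1 (fun i => p i.succ) (fun i j hij => hpa (Fin.succ_le_succ_iff.2 hij))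
    fun i => hp0 _
  have h2 := sum_negMulLog_le p hp0 (by exact_mod_cast hI.card_pos) d.succ_pos hcard
  have h3 := mul_le_mul_of_nonneg_left h2 hL
  rw [Fin.sum_univ_succ] at hcard
  rw [Fin.sum_univ_succ (fun i => p i * x i)] at hpx
  have h4 : ∑ i : Fin d, p i.succ = #I - p 0 := by linarith
  rw [h4] at h1
  -- The mass `p 0` already sits on `x 0`; only `#I - p 0` pays `L`.
  nlinarith [mul_nonneg (hp0 0) hL]

/-! ### Numerical estimates -/

theorem log_le_div_exp_one {u : ℝ} (hu : 0 < u) : log u ≤ u / exp 1 := by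
  have h := Real.log_le_sub_one_of_pos (div_pos hu (exp_pos 1))
  rw [Real.log_div hu.ne' (exp_pos 1).ne', Real.log_exp] at h
  linarith

/-- Induction in steps of two through `Γ(x + 1) = x Γ(x)`. The bound fails at `m = 1`, hence the two
base cases 2 and 3. -/
theorem Gamma_half_add_one_le {m : ℕ} (hm : 2 ≤ m) :
    Real.Gamma ((m : ℝ) / 2 + 1) ≤ √((m : ℝ) / 2) ^ m := by
  induction m using Nat.strong_induction_on with
  | _ m ih =>
    obtain rfl | rfl | hm4 : m = 2 ∨ m = 3 ∨ 4 ≤ m := by omega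
    · norm_num
    · have h1 : Real.Gamma (((3 : ℕ) : ℝ) / 2 + 1) = 3 / 2 * (1 / 2 * √π) := by
        rw [Real.Gamma_add_one (by norm_num)]
        rw [show ((3 : ℕ) : ℝ) / 2 = 1 / 2 + 1 by norm_num, Real.Gamma_add_one (by norm_num),
          Real.Gamma_one_half_eq]
        norm_num
      rw [h1, pow_succ, Real.sq_sqrt (by positivity)]
      have h2 : √π ≤ 2 * √(((3 : ℕ) : ℝ) / 2) := by
        rw [Real.sqrt_le_left (by positivity), mul_pow, Real.sq_sqrt (by positivity)]
        norm_num
        linarith [Real.pi_lt_four]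
      push_cast at h2 ⊢
      linarith
    · obtain ⟨k, rfl⟩ : ∃ k, m = k + 2 := ⟨m - 2, by omega⟩
      have h := ih k (by omega) (by omega)
      have e : ((k + 2 : ℕ) : ℝ) / 2 = (k : ℝ) / 2 + 1 := by push_cast; ring
      rw [e, Real.Gamma_add_one (by positivity), pow_add, Real.sq_sqrt (by positivity), mul_comm]
      refine mul_le_mul_of_nonneg_right (h.trans ?_) (by positivity)
      exact pow_le_pow_left₀ (by positivity) (Real.sqrt_le_sqrt (by linarith)) _

/-- Since `π > 3`, this gives `(2m/π)^(m/2) ≤ m^((m-1)/2)`, which absorbs Minkowski's constant when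
one factor `‖b 0‖` is cancelled. -/
theorem le_three_halves_pow {m : ℕ} (hm : 2 ≤ m) : (m : ℝ) ≤ (3 / 2) ^ m := by
  induction m, hm using Nat.le_induction with
  | base => norm_num
  | succ m hm ih =>
    rw [pow_succ]
    have : (2 : ℝ) ≤ m := by exact_mod_cast hm
    push_cast
    linarith

/-! ### Gram-Schmidt vectors of sublattices and projections -/

-- Minkowski's theorem needs a full-rank lattice; this carries its bound from the span of the first
-- `m` vectors back to the ambient space.
open InnerProductSpace in
theorem gramSchmidt_castLE_isometry {E F : Type*} [NormedAddCommGroup E] [InnerProductSpace ℝ E]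
    [NormedAddCommGroup F] [InnerProductSpace ℝ F] (φ : E →ₗᵢ[ℝ] F) {m d : ℕ} (hm : m ≤ d)
    (g : Fin m → E) (b : Fin d → F) (hb : ∀ i, b (Fin.castLE hm i) = φ (g i)) (i : Fin m) :
    gramSchmidt ℝ b (Fin.castLE hm i) = φ (gramSchmidt ℝ g i) := by
  induction i using WellFoundedLT.induction with
  | _ i ih =>
    rw [gramSchmidt_def, gramSchmidt_def, ← Fin.map_castLEEmb_Iio i hm, Finset.sum_map, map_sub,
      map_sum, hb]
    congr 1
    refine Finset.sum_congr rfl fun j hj => ?_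
    rw [Fin.coe_castLEEmb, ih j (Finset.mem_Iio.1 hj), Submodule.starProjection_singleton,
      Submodule.starProjection_singleton, map_smul, φ.inner_map_map, φ.norm_map]

-- The HKZ recursion thus keeps the same vectors `b_i*`.
open InnerProductSpace in
theorem gramSchmidt_projectedTail {n d : ℕ} (b : Fin (d + 1) → EuclideanSpace ℝ (Fin n))
    (i : Fin d) : gramSchmidt ℝ (projectedTail b) i = gramSchmidt ℝ b i.succ := by
  have h0 : gramSchmidt ℝ b 0 = b 0 := gramSchmidt_bot ℝ b
  induction i using WellFoundedLT.induction with
  | _ i ih =>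
    have hI : Iio i.succ = insert 0 ((Iio i).map (Fin.succEmb d)) := by
      ext j
      refine Fin.cases ?_ (fun j => ?_) j <;> simp
    rw [gramSchmidt_def, gramSchmidt_def, hI, Finset.sum_insert (by simp), Finset.sum_map, h0,
      ← sub_sub]
    have ht : projectedTail b i = b i.succ - (Submodule.span ℝ {b 0}).starProjection (b i.succ) := by
      rw [projectedTail, Submodule.starProjection_orthogonal_val]
    congr 1
    refine Finset.sum_congr rfl fun j hj => ?_
    have horth : inner ℝ (gramSchmidt ℝ b j.succ) (b 0) = 0 := by
      rw [← h0]; exact gramSchmidt_orthogonal ℝ b (Fin.succ_ne_zero j)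
    rw [ih j (Finset.mem_Iio.1 hj), Fin.coe_succEmb, Submodule.starProjection_singleton,
      Submodule.starProjection_singleton, ht, inner_sub_right,
      Submodule.starProjection_singleton ℝ (b i.succ), inner_smul_right, horth, mul_zero, sub_zero]

open InnerProductSpace in
theorem linearIndependent_of_gramSchmidt_ne_zero {E : Type*} [NormedAddCommGroup E]
    [InnerProductSpace ℝ E] {d : ℕ} (b : Fin d → E) (h : ∀ i, gramSchmidt ℝ b i ≠ 0) :
    LinearIndependent ℝ b := by
  have h1 : LinearIndependent ℝ (gramSchmidt ℝ b) :=
    linearIndependent_of_ne_zero_of_inner_eq_zero h fun _ _ => gramSchmidt_orthogonal ℝ b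
  rw [linearIndependent_iff_card_eq_finrank_span] at h1 ⊢
  rwa [Set.finrank, span_gramSchmidt] at h1

open InnerProductSpace in
theorem abs_det_gramSchmidtOrthonormalBasis {E : Type*} [NormedAddCommGroup E]
    [InnerProductSpace ℝ E] [FiniteDimensional ℝ E] {m : ℕ} (f : Fin m → E)
    (h : Module.finrank ℝ E = Fintype.card (Fin m)) (hf : LinearIndependent ℝ f) :
    |(gramSchmidtOrthonormalBasis h f).toBasis.det f| = ∏ i, ‖gramSchmidt ℝ f i‖ := by
  rw [gramSchmidtOrthonormalBasis_det, Finset.abs_prod]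
  refine Finset.prod_congr rfl fun i _ => ?_
  have hne := gramSchmidt_ne_zero (𝕜 := ℝ) i hf
  have hn : gramSchmidtNormed ℝ f i ≠ 0 := by
    intro h0
    have := gramSchmidtNormed_unit_length (𝕜 := ℝ) i hf
    simp [h0] at this
  have hin : inner ℝ (gramSchmidt ℝ f i) (f i) = ‖gramSchmidt ℝ f i‖ ^ 2 := by
    conv_lhs => rw [gramSchmidt_def'' ℝ f i]
    rw [inner_add_right, inner_sum, Finset.sum_eq_zero, add_zero, real_inner_self_eq_norm_sq]
    intro j hj
    rw [inner_smul_right, gramSchmidt_orthogonal ℝ f (Finset.mem_Iio.1 hj).ne', mul_zero]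
  rw [gramSchmidtOrthonormalBasis_apply h hn, gramSchmidtNormed, inner_smul_left, hin]
  have : 0 < ‖gramSchmidt ℝ f i‖ := norm_pos_iff.2 hne
  simp only [conj_trivial, RCLike.ofReal_real_eq_id, id]
  rw [pow_two, inv_mul_cancel_left₀ this.ne', abs_of_pos this]

/-! ### Minkowski's theorem and its logarithmic form -/

open InnerProductSpace MeasureTheory in
/-- **Minkowski's bound** on the radius of a ball that contains no nonzero lattice vector. -/
theorem radius_pow_mul_volume_le {E : Type*} [NormedAddCommGroup E]
    [InnerProductSpace ℝ E] [FiniteDimensional ℝ E] {m : ℕ} (hm : 0 < m) (f : Fin m → E)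
    (h : Module.finrank ℝ E = m) (hf : LinearIndependent ℝ f) {R : ℝ} (hR : 0 ≤ R)
    (hmin : ∀ v ∈ Submodule.span ℤ (Set.range f), v ≠ 0 → R ≤ ‖v‖) :
    R ^ m * (√π ^ m / Real.Gamma ((m : ℝ) / 2 + 1)) ≤ 2 ^ m * ∏ i, ‖gramSchmidt ℝ f i‖ := by
  let _ : MeasurableSpace E := borel E
  have : BorelSpace E := ⟨rfl⟩
  have : Nontrivial E := Module.nontrivial_of_finrank_pos (R := ℝ) (by omega)
  have hcard : Module.finrank ℝ E = Fintype.card (Fin m) := by simpa using h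
  have : Nonempty (Fin m) := ⟨⟨0, hm⟩⟩
  let B : Module.Basis (Fin m) ℝ E := basisOfLinearIndependentOfCardEqFinrank hf hcard.symm
  have hB : ⇑B = f := coe_basisOfLinearIndependentOfCardEqFinrank hf hcard.symm
  let o := gramSchmidtOrthonormalBasis hcard f
  have hvol : volume (ZSpan.fundamentalDomain B) =
      ENNReal.ofReal (∏ i, ‖gramSchmidt ℝ f i‖) := by
    rw [ZSpan.measure_fundamentalDomain B volume o.toBasis,
      measure_congr (ZSpan.fundamentalDomain_ae_parallelepiped o.toBasis volume), hB,
      abs_det_gramSchmidtOrthonormalBasis f hcard hf, OrthonormalBasis.coe_toBasis,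
      o.volume_parallelepiped, mul_one]
  have hle : volume (Metric.ball (0 : E) R) ≤
      volume (ZSpan.fundamentalDomain B) * 2 ^ Module.finrank ℝ E := by
    by_contra! hlt
    have : Countable (Submodule.span ℤ (Set.range B)).toAddSubgroup :=
      inferInstanceAs (Countable (Submodule.span ℤ (Set.range B)))
    obtain ⟨x, hx0, hx⟩ := exists_ne_zero_mem_lattice_of_measure_mul_two_pow_lt_measure
      (ZSpan.isAddFundamentalDomain' B volume) (fun x hx => by simpa using hx)
      (convex_ball (0 : E) R) hlt
    have h1 := hmin x (by rw [← hB]; exact x.2) (by simpa using hx0)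
    rw [mem_ball_zero_iff] at hx
    linarith
  have hG : 0 < Real.Gamma ((m : ℝ) / 2 + 1) := Real.Gamma_pos_of_pos (by positivity)
  rw [hvol, InnerProductSpace.volume_ball, h, ← ENNReal.ofReal_pow hR,
    ← ENNReal.ofReal_mul (by positivity), show (2 : ENNReal) = ENNReal.ofReal 2 by simp,
    ← ENNReal.ofReal_pow (by norm_num), ← ENNReal.ofReal_mul (by positivity),
    ENNReal.ofReal_le_ofReal_iff (by positivity)] at hle
  linarith

theorem latticeMinimum_le_norm {n : ℕ} {L : Submodule ℤ (EuclideanSpace ℝ (Fin n))}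
    {v : EuclideanSpace ℝ (Fin n)} (hv : v ∈ L) (hv0 : v ≠ 0) : latticeMinimum L ≤ ‖v‖ := by
  refine csInf_le ⟨0, ?_⟩ ⟨v, hv, hv0, by simp⟩
  rintro r ⟨w, -, -, hw⟩
  exact (norm_nonneg w).trans (by simpa using hw)

open InnerProductSpace in
/-- Minkowski's bound for a first basis vector that reaches the lattice minimum, applied to the
sublattice spanned by the first `m` basis vectors. -/
theorem norm_head_pow_mul_volume_le {n d : ℕ} (b : Fin (d + 1) → EuclideanSpace ℝ (Fin n))
    (hb : LinearIndependent ℝ b) (hmin : ‖b 0‖ = latticeMinimum (latticeOf b)) {m : ℕ} (hm0 : 0 < m)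
    (hm : m ≤ d + 1) :
    ‖b 0‖ ^ m * (√π ^ m / Real.Gamma ((m : ℝ) / 2 + 1)) ≤
      2 ^ m * ∏ i : Fin m, ‖gramSchmidt ℝ b (Fin.castLE hm i)‖ := by
  have hc : LinearIndependent ℝ (b ∘ Fin.castLE hm) := hb.comp _ (Fin.castLE_injective hm)
  let S := Submodule.span ℝ (Set.range (b ∘ Fin.castLE hm))
  let g : Fin m → S := fun i => ⟨b (Fin.castLE hm i), Submodule.subset_span ⟨i, rfl⟩⟩
  have hg : LinearIndependent ℝ g :=
    LinearIndependent.of_comp S.subtype (by exact hc)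
  have hfin : Module.finrank ℝ S = m := by
    simpa using finrank_span_eq_card hc
  have key := radius_pow_mul_volume_le hm0 g hfin hg (norm_nonneg (b 0)) (by
    intro v hv hv0
    rw [hmin]
    refine (latticeMinimum_le_norm (v := (v : EuclideanSpace ℝ (Fin n))) ?_
      (by simpa using hv0)).trans_eq rfl
    have h1 : (v : EuclideanSpace ℝ (Fin n)) ∈
        (Submodule.span ℤ (Set.range g)).map (S.subtype.restrictScalars ℤ) :=
      Submodule.mem_map_of_mem (f := S.subtype.restrictScalars ℤ) hv
    rw [Submodule.map_span] at h1
    refine Submodule.span_mono ?_ h1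
    rintro _ ⟨_, ⟨i, rfl⟩, rfl⟩
    exact ⟨Fin.castLE hm i, rfl⟩)
  simp_rw [gramSchmidt_castLE_isometry S.subtypeₗᵢ hm g b fun _ => rfl, S.subtypeₗᵢ.norm_map]
  exact key

open InnerProductSpace in
theorem mul_log_norm_head_le {n d : ℕ} (b : Fin (d + 1) → EuclideanSpace ℝ (Fin n))
    (hb : LinearIndependent ℝ b) (hmin : ‖b 0‖ = latticeMinimum (latticeOf b)) {r : ℕ}
    (hr : r ≤ d) :
    r * log ‖b 0‖ ≤ r * (1 / 2 * log (r + 1)) +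
      ∑ i : Fin r, log ‖gramSchmidt ℝ b (Fin.castLE hr i).succ‖ := by
  rcases Nat.eq_zero_or_pos r with rfl | hr0
  · simp
  have hpos : ∀ i, 0 < ‖gramSchmidt ℝ b i‖ := fun i => norm_pos_iff.2 (gramSchmidt_ne_zero i hb)
  have h0 : gramSchmidt ℝ b 0 = b 0 := gramSchmidt_bot ℝ b
  have hb0 : 0 < ‖b 0‖ := h0 ▸ hpos 0
  have key := norm_head_pow_mul_volume_le b hb hmin r.succ_pos (Nat.succ_le_succ hr)
  have hsum : ∑ i : Fin (r + 1), log ‖gramSchmidt ℝ b (Fin.castLE (Nat.succ_le_succ hr) i)‖ =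
      log ‖gramSchmidt ℝ b 0‖ + ∑ i : Fin r, log ‖gramSchmidt ℝ b (Fin.castLE hr i).succ‖ :=
    Fin.sum_univ_succ _
  rw [h0] at hsum
  -- The rank is `m = r + 1`; the product over it contains `‖b 0‖` itself, which is cancelled to
  -- leave the `r` later vectors.
  obtain ⟨m, hmdef⟩ : ∃ m, m = r + 1 := ⟨_, rfl⟩
  have hm2 : 2 ≤ m := by omega
  have hmpos : (0 : ℝ) < m := by positivity
  have hG : 0 < Real.Gamma ((m : ℝ) / 2 + 1) := Real.Gamma_pos_of_pos (by positivity)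
  have hGle := Gamma_half_add_one_le hm2
  have hl : log (‖b 0‖ ^ m * (√π ^ m / Real.Gamma ((m : ℝ) / 2 + 1))) ≤
      log (2 ^ m * ∏ i : Fin (r + 1), ‖gramSchmidt ℝ b (Fin.castLE (Nat.succ_le_succ hr) i)‖) :=
    by
    subst hmdef
    exact Real.log_le_log (by positivity) key
  rw [Real.log_mul (by positivity) (by positivity), Real.log_div (by positivity) hG.ne',
    Real.log_mul (by positivity) (Finset.prod_ne_zero_iff.2 fun i _ => (hpos _).ne'),
    Real.log_prod (fun i _ => (hpos _).ne'), Real.log_pow, Real.log_pow, Real.log_pow,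
    Real.log_sqrt pi_pos.le] at hl
  have hGl := Real.log_le_log hG hGle
  rw [Real.log_pow, Real.log_sqrt (by positivity), Real.log_div hmpos.ne' two_ne_zero] at hGl
  have hpi : log 3 ≤ log π := Real.log_le_log (by norm_num) pi_gt_three.le
  have hm3 := Real.log_le_log hmpos (le_three_halves_pow hm2)
  rw [Real.log_pow, Real.log_div (by norm_num) (by norm_num)] at hm3
  rw [hsum] at hl
  have hmr : (m : ℝ) = r + 1 := by rw [hmdef]; push_cast; ring
  rw [← hmr]
  have hmpi := mul_le_mul_of_nonneg_left hpi hmpos.le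
  have e : (r : ℝ) = m - 1 := by rw [hmr]; ring
  rw [e]
  linarith

/-! ### From HKZ reduction to the theorem -/

open InnerProductSpace in
theorem IsHKZReduced.isTailDominated {n : ℕ} {L : ℝ} : ∀ (d : ℕ)
    (b : Fin d → EuclideanSpace ℝ (Fin n)), LinearIndependent ℝ b → IsHKZReduced d b →
    log d / 2 ≤ L → IsTailDominated L d fun i => log ‖gramSchmidt ℝ b i‖ := by
  intro d
  induction d with
  | zero => intro b _ _ _; trivial
  | succ d ih =>
    intro b hb hred hL
    obtain ⟨-, hmin, htail⟩ := hred
    have h0 : gramSchmidt ℝ b 0 = b 0 := gramSchmidt_bot ℝ b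
    refine ⟨fun w hw hw0 => ?_, ?_⟩
    -- Minkowski's bound at each `r` is nonnegativity of a prefix sum.
    · have h1 := sum_mul_nonneg_of_antitone w
        (fun i => log ‖gramSchmidt ℝ b i.succ‖ + L - log ‖b 0‖) hw hw0 (fun r hr => by
          have h2 := mul_log_norm_head_le b hb hmin hr
          have h3 : log ((r : ℝ) + 1) ≤ log ((d + 1 : ℕ) : ℝ) := by
            refine Real.log_le_log (by positivity) ?_
            push_cast
            have : (r : ℝ) ≤ d := by exact_mod_cast hr
            linarith
          have h4 := mul_le_mul_of_nonneg_left
            (show 1 / 2 * log ((r : ℝ) + 1) ≤ L by linarith) (Nat.cast_nonneg (α := ℝ) r)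
          simp only [Finset.sum_sub_distrib, Finset.sum_add_distrib, Finset.sum_const,
            Finset.card_univ, Fintype.card_fin, nsmul_eq_mul]
          linarith)
      simp only [mul_sub, mul_add, Finset.sum_sub_distrib, Finset.sum_add_distrib,
        ← Finset.sum_mul] at h1
      simp only [h0]
      linarith
    · have hli : LinearIndependent ℝ (projectedTail b) :=
        linearIndependent_of_gramSchmidt_ne_zero _ fun i => by
          rw [gramSchmidt_projectedTail]; exact gramSchmidt_ne_zero _ hb
      have h1 := ih _ hli htail (le_trans ?_ hL)
      · simpa only [gramSchmidt_projectedTail] using h1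
      · rcases Nat.eq_zero_or_pos d with rfl | hd
        · simp
        · have : log (d : ℝ) ≤ log ((d + 1 : ℕ) : ℝ) :=
            Real.log_le_log (by positivity) (by push_cast; linarith)
          linarith

theorem mainTheorem1 {n d : ℕ} (hd : 0 < d) (b : Fin d → EuclideanSpace ℝ (Fin n))
    (hb : LinearIndependent ℝ b) (hred : IsHKZReduced d b) (I : Finset (Fin d)) :
    ‖b ⟨0, hd⟩‖ ^ I.card / ∏ i ∈ I, ‖InnerProductSpace.gramSchmidt ℝ b i‖
        ≤ Real.sqrt (d : ℝ) ^ ((I.card : ℝ) * (1 + Real.log ((d : ℝ) / (I.card : ℝ)))) ∧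
      Real.sqrt (d : ℝ) ^ ((I.card : ℝ) * (1 + Real.log ((d : ℝ) / (I.card : ℝ))))
        ≤ Real.sqrt (d : ℝ) ^ ((d : ℝ) / Real.exp 1 + (I.card : ℝ)) := by
  obtain ⟨d, rfl⟩ : ∃ k, d = k + 1 := ⟨d - 1, by omega⟩
  have hd1 : (1 : ℝ) ≤ ((d + 1 : ℕ) : ℝ) := by push_cast; linarith [Nat.cast_nonneg (α := ℝ) d]
  have hs1 : 1 ≤ √((d + 1 : ℕ) : ℝ) := Real.one_le_sqrt.2 hd1
  have hpos : ∀ i, 0 < ‖InnerProductSpace.gramSchmidt ℝ b i‖ := fun i =>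
    norm_pos_iff.2 (InnerProductSpace.gramSchmidt_ne_zero i hb)
  have h0 : InnerProductSpace.gramSchmidt ℝ b 0 = b 0 := InnerProductSpace.gramSchmidt_bot ℝ b
  constructor
  · rcases I.eq_empty_or_nonempty with rfl | hI
    · simp
    · have hL : log ((d + 1 : ℕ) : ℝ) / 2 ≤ log √((d + 1 : ℕ) : ℝ) :=
        (Real.log_sqrt (Nat.cast_nonneg _)).ge
      have hT := IsHKZReduced.isTailDominated (d + 1) b hb hred hL
      have h1 := isTailDominated_mul_sub_sum_le (Real.log_nonneg hs1) _ hT I hI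
      have hb0 : 0 < ‖b ⟨0, hd⟩‖ := by
        have := hpos 0
        rwa [h0] at this
      have hP : 0 < ∏ i ∈ I, ‖InnerProductSpace.gramSchmidt ℝ b i‖ :=
        Finset.prod_pos fun i _ => hpos i
      have hlog : log (‖b ⟨0, hd⟩‖ ^ #I / ∏ i ∈ I, ‖InnerProductSpace.gramSchmidt ℝ b i‖) =
          #I * log ‖b 0‖ - ∑ i ∈ I, log ‖InnerProductSpace.gramSchmidt ℝ b i‖ := by
        rw [Real.log_div (pow_ne_zero _ hb0.ne') hP.ne', Real.log_pow,
          Real.log_prod fun i _ => (hpos i).ne']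
        rfl
      simp only [h0] at h1
      rw [Real.rpow_def_of_pos (zero_lt_one.trans_le hs1),
        ← Real.log_le_iff_le_exp (div_pos (pow_pos hb0 _) hP), hlog]
      exact h1
  · refine Real.rpow_le_rpow_of_exponent_le hs1 ?_
    rcases I.eq_empty_or_nonempty with rfl | hI
    · simp only [card_empty, Nat.cast_zero, zero_mul, add_zero]
      positivity
    · have hk : (0 : ℝ) < #I := by exact_mod_cast hI.card_pos
      -- `k log (d / k) ≤ d / e`, from `log u ≤ u / e` at `u = d / k`.
      have h1 := mul_le_mul_of_nonneg_left
        (log_le_div_exp_one (u := ((d + 1 : ℕ) : ℝ) / #I) (by positivity)) hk.le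
      have h2 : (#I : ℝ) * (((d + 1 : ℕ) : ℝ) / #I / exp 1) = ((d + 1 : ℕ) : ℝ) / exp 1 := by
        field_simp
      linarith
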